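/- For every prime $p$ there is a constant $c_p>0$, depending only on $p$, such that the following holds for all integers $k\ge 6$ and $n\ge 0$. Let $a_1,\dots,a_k\in\mathbb F_p^*=\mathbb F_p\setminus\{0\}$ satisfy $a_1+\dots+a_k=0$, and suppose that $A\subseteq\mathbb F_p^n$ contains no pairwise distinct elements $x_1,\dots,x_k\in A$ with $a_1x_1+\dots+a_kx_k=0$. Then $$|A|\le k\,p^n\exp\Bigl(-c_p\min\bigl\{(k^3\log_2 p^n)^{1/5},\ \log_2 p^n\bigr\}\Bigr).$$ In particular, $|A|\le k\,p^n\exp\bigl(-c_p(k^3\log_2 p^n)^{1/5}\bigr)$ whenever $k^3\le(\log_2 p^n)^4$, and hence, for each fixed $k$, for all sufficiently large $n$. -/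

import Mathlib

/-! Write `q = p ^ n` and let `δ` be the density of `A`. The argument gives a power saving: the
exponent can be taken to be a multiple of `log q`, and the minimum in the statement enters only as a
quantity that is at most `log q`.

The core is the three-variable case. The polynomial method (`card_le_three_mul_card_lowExponents`)
bounds sets with only constant solutions, and averaging over random affine images of a small space
turns this into supersaturation with polynomial loss: at least `κ δ ^ C q ^ 2` pairs `(w, e)` have
`w`, `w + a₂ e`, `w - a₁ e` in `A` (`exists_le_card_triplePairs`). Hence one nonzero `e` works for
many `w`. Since `a₁ (w + a₂ e) + a₂ (w - a₁ e) = (a₁ + a₂) w`, two variables whose coefficients have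
nonzero sum can be merged into a single variable ranging over these `w`. For odd `p`, repeated
merging reduces any equation of bounded length to three variables.

The losses grow with the number of variables, so a long equation is first cut into zero-sum blocks
of bounded length by the Erdős–Ginzburg–Ziv theorem. The blocks are solved one after another,
deleting the points already used; this costs at most `k` points in total.

For `p = 2` all coefficients are `1` and no pair can be merged; there blocks of four and six
variables are solved by parallelograms `x, x + e, x + f, x + e + f`. -/

/-! ### The polynomial method for three-variable equations -/

/-- A subspace of a coordinate space contains a vector with at least as many nonzero coordinates
as the dimension of the subspace. -/
theorem exists_mem_finrank_le_card_support {F ι : Type*} [Field F] [DecidableEq F] [Fintype ι]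
    (W : Submodule F (ι → F)) :
    ∃ w ∈ W, Module.finrank F W ≤ (Finset.univ.filter fun i => w i ≠ 0).card := by
  classical
  have hex : ∃ m, ∃ w ∈ W, (Finset.univ.filter fun i => w i ≠ 0).card = m :=
    ⟨_, 0, W.zero_mem, rfl⟩
  let P : ℕ → Prop := fun m => ∃ w ∈ W, (Finset.univ.filter fun i => w i ≠ 0).card = m
  have hP : P (Nat.findGreatest P (Fintype.card ι)) := by
    obtain ⟨m, w, hw, hm⟩ := hex
    exact Nat.findGreatest_spec (P := P) (m := m) (hm ▸ Finset.card_le_univ _) ⟨w, hw, hm⟩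
  obtain ⟨w, hw, hcard⟩ := hP
  refine ⟨w, hw, ?_⟩
  by_contra! hlt
  let S := Finset.univ.filter fun i => w i ≠ 0
  -- If the maximal support `S` is smaller than `dim W`, some nonzero vector of `W` vanishes on `S`;
  -- adding it to `w` enlarges the support.
  let f : W →ₗ[F] (S → F) := (LinearMap.funLeft F F (Subtype.val : S → ι)).comp W.subtype
  have hker : LinearMap.ker f ≠ ⊥ := by
    apply LinearMap.ker_ne_bot_of_finrank_lt
    simpa using hlt
  obtain ⟨v, hv, hv0⟩ := (Submodule.ne_bot_iff _).1 hker
  have hvS : ∀ i, w i ≠ 0 → (v : ι → F) i = 0 := by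
    intro i hi
    have := congrFun (LinearMap.mem_ker.1 hv) ⟨i, by simp [S, hi]⟩
    simpa [f, LinearMap.funLeft] using this
  obtain ⟨j, hj⟩ : ∃ j, (v : ι → F) j ≠ 0 := by
    by_contra! h
    exact hv0 (Subtype.ext (funext h))
  have hwj : w j = 0 := by
    by_contra h
    exact hj (hvS j h)
  have hlt2 : S.card < (Finset.univ.filter fun i => (w + (v : ι → F)) i ≠ 0).card := by
    apply Finset.card_lt_card
    refine Finset.ssubset_iff_of_subset ?_ |>.2 ⟨j, ?_, ?_⟩
    · intro i hi
      have hi' : w i ≠ 0 := by simpa [S] using hi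
      simpa [hvS i hi'] using hi'
    · simpa [hwj] using hj
    · simp [S, hwj]
  have := Nat.findGreatest_is_greatest (P := P) (n := Fintype.card ι) (hcard ▸ hlt2)
    (Finset.card_le_univ _)
  exact this ⟨_, W.add_mem hw v.2, rfl⟩

/-- The monomial with exponent vector `α`, evaluated at `x`. -/
def monomialEval {d : ℕ} {R : Type*} [CommSemiring R] (α : Fin d → ℕ) (x : Fin d → R) : R :=
  ∏ t, x t ^ α t

/-- Exponent vectors with entries below `p` and total degree at most a third of the maximum. -/
def lowExponents (p d : ℕ) : Finset (Fin d → ℕ) :=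
  (Fintype.piFinset fun _ => Finset.range p).filter fun α => 3 * ∑ t, α t ≤ (p - 1) * d

/-- The indicator function of a linear equation in three variables over `ZMod p`, as a polynomial. -/
theorem one_sub_linear_pow_eq_sum {p : ℕ} [Fact p.Prime] (b : Fin 3 → ZMod p) :
    ∃ (I : Finset (Fin 3 → ℕ)) (c : (Fin 3 → ℕ) → ZMod p),
      (∀ k ∈ I, k 0 + k 1 + k 2 ≤ p - 1) ∧
      ∀ x y z : ZMod p, 1 - (b 0 * x + b 1 * y + b 2 * z) ^ (p - 1) =
        ∑ k ∈ I, c k * (x ^ k 0 * y ^ k 1 * z ^ k 2) := by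
  classical
  have hp : 0 < p - 1 := Nat.sub_pos_of_lt (Fact.out : p.Prime).one_lt
  -- The exponent vector `0` carries the constant term `1`; it does not collide with the multinomial
  -- terms, whose degree is `p - 1 > 0`.
  refine ⟨insert 0 (Finset.piAntidiag Finset.univ (p - 1)),
    fun k => if k = 0 then 1 else
      -((Nat.multinomial Finset.univ k : ZMod p) * (b 0 ^ k 0 * b 1 ^ k 1 * b 2 ^ k 2)), ?_, ?_⟩
  · intro k hk
    rcases Finset.mem_insert.1 hk with rfl | hk
    · simp
    · have := (Finset.mem_piAntidiag.1 hk).1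
      rw [Fin.sum_univ_three] at this
      exact this.le
  · intro x y z
    have h0 : (0 : Fin 3 → ℕ) ∉ Finset.piAntidiag Finset.univ (p - 1) := by
      intro h
      have := (Finset.mem_piAntidiag.1 h).1
      simp at this
      omega
    rw [Finset.sum_insert h0]
    have hpow := Finset.sum_pow_eq_sum_piAntidiag (Finset.univ : Finset (Fin 3)) ![b 0 * x, b 1 * y, b 2 * z] (p - 1)
    rw [Fin.sum_univ_three] at hpow
    simp only [Matrix.cons_val] at hpow
    rw [hpow, sub_eq_add_neg, ← Finset.sum_neg_distrib]
    simp only [if_true, Pi.zero_apply, pow_zero, mul_one]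
    congr 1
    refine Finset.sum_congr rfl fun k hk => ?_
    have hk0 : k ≠ 0 := by
      rintro rfl
      exact h0 hk
    simp only [hk0, if_false, Fin.prod_univ_three, Matrix.cons_val, mul_pow]
    ring

theorem rank_matrix_add_le {F X Y : Type*} [Field F] [Fintype X] [Fintype Y]
    (M N : Matrix X Y F) : (M + N).rank ≤ M.rank + N.rank := by
  have hle : LinearMap.range (M + N).mulVecLin ≤
      LinearMap.range M.mulVecLin ⊔ LinearMap.range N.mulVecLin := by
    rintro _ ⟨v, rfl⟩
    rw [Matrix.mulVecLin_add, LinearMap.add_apply]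
    exact Submodule.add_mem_sup ⟨v, rfl⟩ ⟨v, rfl⟩
  exact (Submodule.finrank_mono hle).trans (Submodule.finrank_add_le_finrank_add_finrank _ _)

theorem rank_of_sum_mul_le {F X Y L : Type*} [Field F] [Fintype X] [Fintype Y]
    (S : Finset L) (u : L → X → F) (v : L → Y → F) :
    (Matrix.of fun x y => ∑ l ∈ S, u l x * v l y).rank ≤ S.card := by
  have : (Matrix.of fun x y => ∑ l ∈ S, u l x * v l y) =
      (Matrix.of fun x (l : S) => u l x) * (Matrix.of fun (l : S) y => v l y) := by
    ext x y
    simpa [Matrix.mul_apply] using (Finset.sum_attach S fun l => u l x * v l y).symm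
  rw [this]
  refine (Matrix.rank_mul_le_left _ _).trans ((Matrix.rank_le_card_width _).trans ?_)
  simp

/-- The polynomial method bound for sets in which a translation invariant equation in three
variables has only the constant solutions. -/
theorem card_le_three_mul_card_lowExponents {p : ℕ} [Fact p.Prime] {d : ℕ} (b : Fin 3 → ZMod p)
    (hb : b 0 + b 1 + b 2 = 0) (A : Finset (Fin d → ZMod p))
    (hA : ∀ x ∈ A, ∀ y ∈ A, ∀ z ∈ A, b 0 • x + b 1 • y + b 2 • z = 0 → x = y ∧ x = z) :
    A.card ≤ 3 * (lowExponents p d).card := by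
  classical
  have hp1 : p - 1 ≠ 0 := (Nat.sub_pos_of_lt (Fact.out : p.Prime).one_lt).ne'
  obtain ⟨I, c, hI, hc⟩ := one_sub_linear_pow_eq_sum b
  set J : Finset (Fin d → Fin 3 → ℕ) := Fintype.piFinset fun _ => I with hJ
  let C : (Fin d → Fin 3 → ℕ) → ZMod p := fun τ => ∏ t, c (τ t)
  let f : (Fin d → ZMod p) → (Fin d → ZMod p) → (Fin d → ZMod p) → ZMod p :=
    fun x y z => ∏ t, (1 - (b 0 * x t + b 1 * y t + b 2 * z t) ^ (p - 1))
  let ex : Fin 3 → (Fin d → Fin 3 → ℕ) → Fin d → ℕ := fun j τ t => τ t j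
  have hf : ∀ x y z, f x y z = ∑ τ ∈ J, C τ *
      (monomialEval (ex 0 τ) x * monomialEval (ex 1 τ) y * monomialEval (ex 2 τ) z) := by
    intro x y z
    simp only [f, hc, hJ, C, monomialEval, ex, ← Finset.prod_mul_distrib]
    exact Finset.prod_univ_sum (fun _ => I)
      (fun t k => c k * (x t ^ k 0 * y t ^ k 1 * z t ^ k 2))
  have hfdiag : ∀ x ∈ A, ∀ y ∈ A, ∀ z ∈ A, f x y z = if x = y ∧ x = z then 1 else 0 := by
    intro x hx y hy z hz
    split_ifs with h
    · obtain ⟨rfl, rfl⟩ := h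
      refine Finset.prod_eq_one fun t _ => ?_
      rw [← add_mul, ← add_mul, hb, zero_mul, zero_pow hp1, sub_zero]
    · have hne : b 0 • x + b 1 • y + b 2 • z ≠ 0 := fun h0 => h (hA x hx y hy z hz h0)
      obtain ⟨t, ht⟩ := Function.ne_iff.1 hne
      refine Finset.prod_eq_zero (Finset.mem_univ t) ?_
      rw [ZMod.pow_card_sub_one_eq_one (by simpa using ht), sub_self]
  -- Each monomial has total degree at most `(p - 1) d`, so one of its three factors has at most a
  -- third of that.
  have hlow : ∀ τ ∈ J, ex 0 τ ∈ lowExponents p d ∨ ex 1 τ ∈ lowExponents p d ∨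
      ex 2 τ ∈ lowExponents p d := by
    intro τ hτ
    have hτI : ∀ t, τ t 0 + τ t 1 + τ t 2 ≤ p - 1 := fun t => hI _ (Fintype.mem_piFinset.1 hτ t)
    have hsum : ∑ t, τ t 0 + ∑ t, τ t 1 + ∑ t, τ t 2 ≤ (p - 1) * d := by
      rw [← Finset.sum_add_distrib, ← Finset.sum_add_distrib]
      calc _ ≤ ∑ _t : Fin d, (p - 1) := Finset.sum_le_sum fun t _ => hτI t
        _ = _ := by simp [mul_comm]
    have hmem : ∀ j, 3 * ∑ t, τ t j ≤ (p - 1) * d → ex j τ ∈ lowExponents p d := by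
      intro j hj
      refine Finset.mem_filter.2 ⟨Fintype.mem_piFinset.2 fun t => Finset.mem_range.2 ?_, hj⟩
      have := hτI t
      have : τ t j ≤ p - 1 := by
        fin_cases j <;> simp <;> omega
      simp only [ex]
      omega
    by_contra! h
    have h0 := mt (hmem 0) h.1
    have h1 := mt (hmem 1) h.2.1
    have h2 := mt (hmem 2) h.2.2
    omega
  -- a vector on `A` orthogonal to all low monomials
  let ev : (A → ZMod p) →ₗ[ZMod p] (lowExponents p d → ZMod p) :=
    Matrix.mulVecLin (Matrix.of fun (γ : lowExponents p d) (z : A) => monomialEval γ.1 z.1)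
  obtain ⟨h, hhW, hhcard⟩ := exists_mem_finrank_le_card_support (LinearMap.ker ev)
  have hdim : A.card ≤ Module.finrank (ZMod p) (LinearMap.ker ev) + (lowExponents p d).card := by
    have h1 := LinearMap.finrank_range_add_finrank_ker ev
    have h2 : Module.finrank (ZMod p) (LinearMap.range ev) ≤ (lowExponents p d).card := by
      simpa using Submodule.finrank_le (LinearMap.range ev)
    have h3 : Module.finrank (ZMod p) (A → ZMod p) = A.card := by simp
    omega
  have horth : ∀ γ ∈ lowExponents p d, ∑ z : A, h z * monomialEval γ z.1 = 0 := by
    intro γ hγ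
    have := congrFun (LinearMap.mem_ker.1 hhW) ⟨γ, hγ⟩
    simp only [mul_comm (h _)]
    exact this
  let g : (Fin d → Fin 3 → ℕ) → ZMod p := fun τ => ∑ z : A, h z * monomialEval (ex 2 τ) z.1
  let J0 := J.filter fun τ => ex 0 τ ∈ lowExponents p d
  let J1 := J.filter fun τ => ex 0 τ ∉ lowExponents p d ∧ ex 1 τ ∈ lowExponents p d
  -- Summing `f x y z` against `h` over `z` gives `diagonal h`. Orthogonality kills the monomials
  -- that are low only in `z`; the others are grouped by their low factor in `x` or in `y`, so each
  -- group has rank at most the number of low monomials. The rank of `diagonal h` is the support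
  -- size of `h`, which is large by choice.
  have hmat : Matrix.diagonal h =
      (Matrix.of fun (x y : A) => ∑ α ∈ lowExponents p d, monomialEval α x.1 *
        ∑ τ ∈ J0 with ex 0 τ = α, C τ * g τ * monomialEval (ex 1 τ) y.1) +
      (Matrix.of fun (x y : A) => ∑ α ∈ lowExponents p d,
        (∑ τ ∈ J1 with ex 1 τ = α, C τ * g τ * monomialEval (ex 0 τ) x.1) *
          monomialEval α y.1) := by
    ext x y
    have h1 : Matrix.diagonal h x y = ∑ z : A, h z * f x y z := by
      rw [Matrix.diagonal_apply]
      have : ∀ z : A, h z * f x y z = if x = y ∧ x = z then h z else 0 := by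
        intro z
        rw [hfdiag x x.2 y y.2 z z.2]
        simp only [Subtype.coe_inj, mul_ite, mul_one, mul_zero]
      rw [Finset.sum_congr rfl fun z _ => this z]
      by_cases hxy : x = y
      · simp only [hxy, true_and, if_true]
        rw [Finset.sum_ite_eq]
        simp
      · simp only [hxy, false_and, if_false, Finset.sum_const_zero]
    have h2 : ∑ z : A, h z * f x y z = ∑ τ ∈ J, C τ * g τ *
        (monomialEval (ex 0 τ) x.1 * monomialEval (ex 1 τ) y.1) := by
      calc ∑ z : A, h z * f x y z = ∑ z : A, ∑ τ ∈ J, h z * (C τ * (monomialEval (ex 0 τ) x.1 *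
            monomialEval (ex 1 τ) y.1 * monomialEval (ex 2 τ) z.1)) :=
          Finset.sum_congr rfl fun z _ => by rw [hf, Finset.mul_sum]
        _ = ∑ τ ∈ J, ∑ z : A, h z * (C τ * (monomialEval (ex 0 τ) x.1 *
            monomialEval (ex 1 τ) y.1 * monomialEval (ex 2 τ) z.1)) := Finset.sum_comm
        _ = _ := Finset.sum_congr rfl fun τ _ => by
          rw [Finset.mul_sum, Finset.sum_mul]
          refine Finset.sum_congr rfl fun z _ => ?_
          ring
    rw [h1, h2, Matrix.add_apply, Matrix.of_apply, Matrix.of_apply]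
    rw [← Finset.sum_filter_add_sum_filter_not J (fun τ => ex 0 τ ∈ lowExponents p d)]
    congr 1
    · rw [← Finset.sum_fiberwise_of_maps_to (t := lowExponents p d) (g := ex 0)
        (fun τ hτ => (Finset.mem_filter.1 hτ).2)]
      refine Finset.sum_congr rfl fun α _ => ?_
      rw [Finset.mul_sum]
      refine Finset.sum_congr rfl fun τ hτ => ?_
      rw [← (Finset.mem_filter.1 hτ).2]
      ring
    · have h3 : ∑ τ ∈ J with ex 0 τ ∉ lowExponents p d, C τ * g τ *
          (monomialEval (ex 0 τ) x.1 * monomialEval (ex 1 τ) y.1) =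
          ∑ τ ∈ J1, C τ * g τ *
          (monomialEval (ex 0 τ) x.1 * monomialEval (ex 1 τ) y.1) := by
        symm
        refine Finset.sum_subset ?_ ?_
        · intro τ hτ
          simp only [J1, Finset.mem_filter] at hτ ⊢
          exact ⟨hτ.1, hτ.2.1⟩
        · intro τ hτ hτ'
          simp only [J1, Finset.mem_filter] at hτ hτ'
          have h2low : ex 2 τ ∈ lowExponents p d := by
            rcases hlow τ hτ.1 with h | h | h
            · exact absurd h hτ.2
            · exact absurd ⟨hτ.1, hτ.2, h⟩ hτ'
            · exact h
          have : g τ = 0 := horth _ h2low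
          simp [this]
      rw [h3, ← Finset.sum_fiberwise_of_maps_to (t := lowExponents p d) (g := ex 1)
        (fun τ hτ => (Finset.mem_filter.1 hτ).2.2)]
      refine Finset.sum_congr rfl fun α _ => ?_
      rw [Finset.sum_mul]
      refine Finset.sum_congr rfl fun τ hτ => ?_
      rw [← (Finset.mem_filter.1 hτ).2]
      ring
  have hrank : (Matrix.diagonal h).rank ≤ 2 * (lowExponents p d).card := by
    rw [hmat, two_mul]
    exact (rank_matrix_add_le _ _).trans
      (add_le_add (rank_of_sum_mul_le _ _ _) (rank_of_sum_mul_le _ _ _))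
  rw [Matrix.rank_diagonal, Fintype.card_subtype] at hrank
  omega

/-! ### Counting monomials of low degree -/

/-- The two sides agree at `μ = 1`, where their derivatives are `3 p (p - 1) / 2` and `p (p - 1)`;
just to the left of `1` the sum is therefore smaller. This is the saving in an exponential Markov
inequality for the degree. -/
theorem exists_sum_pow_lt (p : ℕ) (hp : 2 ≤ p) :
    ∃ μ : ℝ, 0 < μ ∧ μ < 1 ∧ ∑ i ∈ Finset.range p, μ ^ (3 * i) < p * μ ^ (p - 1) := by
  let g : ℝ → ℝ := fun μ => p * μ ^ (p - 1) - ∑ i ∈ Finset.range p, μ ^ (3 * i)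
  let g' : ℝ := p * ((p - 1 : ℕ) : ℝ) - ∑ i ∈ Finset.range p, 3 * (i : ℝ)
  have hg : HasDerivAt g g' 1 := by
    have h1 : HasDerivAt (fun μ : ℝ => (p : ℝ) * μ ^ (p - 1)) (p * ((p - 1 : ℕ) : ℝ)) 1 := by
      simpa using (hasDerivAt_pow (p - 1) (1 : ℝ)).const_mul (p : ℝ)
    have h2 : HasDerivAt (fun μ : ℝ => ∑ i ∈ Finset.range p, μ ^ (3 * i))
        (∑ i ∈ Finset.range p, 3 * (i : ℝ)) 1 := by
      refine HasDerivAt.fun_sum fun i _ => ?_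
      simpa using hasDerivAt_pow (3 * i) (1 : ℝ)
    exact h1.sub h2
  have hg'neg : g' < 0 := by
    have h := Finset.sum_range_id_mul_two p
    have h2 : (∑ i ∈ Finset.range p, (i : ℝ)) * 2 = p * ((p - 1 : ℕ) : ℝ) := by
      rw [← Nat.cast_mul, ← h]
      push_cast
      rfl
    have h3 : (0 : ℝ) < p * ((p - 1 : ℕ) : ℝ) := by
      have : 0 < p - 1 := by omega
      positivity
    simp only [g', ← Finset.mul_sum]
    linarith
  have hg1 : g 1 = 0 := by simp [g]
  have hev := (hg.tendsto_slope.mono_left (nhdsWithin_mono 1 (s := Set.Iio 1)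
    (fun x hx => ne_of_lt hx))).eventually (gt_mem_nhds hg'neg)
  have h0 : ∀ᶠ μ : ℝ in nhdsWithin 1 (Set.Iio 1), 0 < μ :=
    nhdsWithin_le_nhds (lt_mem_nhds one_pos)
  obtain ⟨μ, ⟨hslope, hpos⟩, hlt⟩ := ((hev.and h0).and self_mem_nhdsWithin).exists
  refine ⟨μ, hpos, hlt, ?_⟩
  rw [slope_def_field, hg1, sub_zero] at hslope
  have : 0 < g μ := by
    by_contra! h
    have : 0 ≤ g μ / (μ - 1) := div_nonneg_of_nonpos h (by linarith [show μ < 1 from hlt])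
    linarith
  simp only [g] at this
  linarith

/-- The number of monomials of low degree is exponentially smaller than `p ^ d`. -/
theorem exists_card_lowExponents_le (p : ℕ) (hp : 2 ≤ p) :
    ∃ ρ : ℝ, 0 < ρ ∧ ρ < 1 ∧ ∀ d, ((lowExponents p d).card : ℝ) ≤ (ρ * p) ^ d := by
  obtain ⟨μ, h0, h1, hμ⟩ := exists_sum_pow_lt p hp
  have hp0 : (0 : ℝ) < p := by positivity
  refine ⟨(∑ i ∈ Finset.range p, μ ^ (3 * i)) / μ ^ (p - 1) / p, ?_, ?_, fun d => ?_⟩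
  · have : 0 < ∑ i ∈ Finset.range p, μ ^ (3 * i) :=
      Finset.sum_pos (fun i _ => by positivity) (Finset.nonempty_range_iff.2 (by omega))
    positivity
  · rw [div_div, div_lt_one (by positivity), mul_comm]
    exact hμ
  · rw [div_mul_cancel₀ _ hp0.ne', div_pow, ← pow_mul, le_div_iff₀ (by positivity)]
    calc ((lowExponents p d).card : ℝ) * μ ^ ((p - 1) * d)
        = ∑ _α ∈ lowExponents p d, μ ^ ((p - 1) * d) := by rw [Finset.sum_const, nsmul_eq_mul]
      _ ≤ ∑ α ∈ lowExponents p d, μ ^ (3 * ∑ t, α t) :=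
        Finset.sum_le_sum fun α hα =>
          pow_le_pow_of_le_one h0.le h1.le (Finset.mem_filter.1 hα).2
      _ ≤ ∑ α ∈ Fintype.piFinset fun _ : Fin d => Finset.range p, μ ^ (3 * ∑ t, α t) :=
        Finset.sum_le_sum_of_subset_of_nonneg (Finset.filter_subset _ _)
          fun _ _ _ => by positivity
      _ = ∑ α ∈ Fintype.piFinset fun _ : Fin d => Finset.range p, ∏ t, μ ^ (3 * α t) :=
        Finset.sum_congr rfl fun α _ => by rw [Finset.prod_pow_eq_pow_sum, Finset.mul_sum]
      _ = ∏ _t : Fin d, ∑ i ∈ Finset.range p, μ ^ (3 * i) :=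
        (Finset.prod_univ_sum (fun _ => Finset.range p) (fun _ i => μ ^ (3 * i))).symm
      _ = _ := by simp

/-! ### Supersaturation through random affine images -/

/-- The pairs `(w, e)` for which `w`, `w + a₂ e` and `w - a₁ e` all lie in `A`. -/
def triplePairs {R V : Type*} [Ring R] [AddCommGroup V] [Module R V] [Fintype V] [DecidableEq V]
    (a₁ a₂ : R) (A : Finset V) : Finset (V × V) :=
  Finset.univ.filter fun w => w.1 ∈ A ∧ w.1 + a₂ • w.2 ∈ A ∧ w.1 - a₁ • w.2 ∈ A

/-- As `a₂ ≠ 0`, the triples `w`, `w + a₂ e`, `w - a₁ e` are exactly the solutions of the equation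
with coefficients `-(a₁ + a₂)`, `a₁`, `a₂`, and `e = 0` gives the constant ones. -/
theorem exists_triplePairs_ne_zero {p : ℕ} [Fact p.Prime] {d : ℕ} {a₁ a₂ : ZMod p}
    (h₂ : a₂ ≠ 0) (A : Finset (Fin d → ZMod p))
    (hA : 3 * (lowExponents p d).card < A.card) :
    ∃ w ∈ triplePairs a₁ a₂ A, w.2 ≠ 0 := by
  by_contra! h
  refine hA.not_ge (card_le_three_mul_card_lowExponents ![-(a₁ + a₂), a₁, a₂] (by simp) A ?_)
  intro x hx y hy z hz hxyz
  simp only [Matrix.cons_val] at hxyz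
  have hy' : x + a₂ • a₂⁻¹ • (y - x) = y := by
    rw [smul_inv_smul₀ h₂]
    abel
  have hz' : x - a₁ • a₂⁻¹ • (y - x) = z := by
    rw [← sub_eq_zero, ← smul_right_injective (Fin d → ZMod p) h₂ |>.eq_iff]
    rw [smul_zero, smul_sub, smul_sub, smul_comm a₂ a₁, smul_inv_smul₀ h₂, ← neg_eq_zero,
      ← hxyz]
    module
  have he := h (x, a₂⁻¹ • (y - x)) (by
    simp only [triplePairs, Finset.mem_filter, Finset.mem_univ, true_and, hy', hz']
    exact ⟨hx, hy, hz⟩)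
  simp only at he
  rw [he] at hy' hz'
  simp only [smul_zero, add_zero, sub_zero] at hy' hz'
  exact ⟨hy', hz'⟩

/-- All fibres of a surjective homomorphism have the same size, so a uniform element has a uniform
image. -/
theorem card_filter_mem_mul_card {G H : Type*} [AddGroup G] [AddGroup H] [Fintype G] [Fintype H]
    [DecidableEq H] (φ : G →+ H) (hφ : Function.Surjective φ) (S : Finset H) :
    (Finset.univ.filter fun g => φ g ∈ S).card * Fintype.card H = S.card * Fintype.card G := by
  classical
  have hfib : ∀ y : H, (Finset.univ.filter fun g => φ g = y).card =
      (Finset.univ.filter fun g => φ g = 0).card := fun y =>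
    AddMonoidHom.card_fiber_eq_of_mem_range φ (hφ y) (hφ 0)
  have hT : ∀ T : Finset H, (Finset.univ.filter fun g => φ g ∈ T).card =
      T.card * (Finset.univ.filter fun g => φ g = 0).card := by
    intro T
    rw [Finset.card_eq_sum_card_fiberwise (f := φ) (t := T) (fun g hg => by simpa using hg),
      ← smul_eq_mul, ← Finset.sum_const]
    refine Finset.sum_congr rfl fun y hy => ?_
    rw [← hfib y, Finset.filter_filter]
    congr 1
    ext g
    simp only [Finset.mem_filter, Finset.mem_univ, true_and, and_iff_right_iff_imp]
    rintro rfl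
    exact hy
  have hG := hT Finset.univ
  simp only [Finset.mem_univ, Finset.filter_true, Finset.card_univ] at hG
  rw [hT S, hG]
  ring

/-- The affine map with translation part `ω.1` and linear part `ω.2`. -/
def affineEval {R V : Type*} {d : ℕ} [Ring R] [AddCommGroup V] [Module R V] (u : Fin d → R) :
    (V × (Fin d → V)) →+ V where
  toFun ω := ω.1 + ∑ j, u j • ω.2 j
  map_zero' := by simp
  map_add' ω ω' := by
    simp only [Prod.fst_add, Prod.snd_add, Pi.add_apply, smul_add, Finset.sum_add_distrib]
    abel

/-- The linear part of an affine map, evaluated at `g`. -/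
def linearEval {R V : Type*} {d : ℕ} [Ring R] [AddCommGroup V] [Module R V] (g : Fin d → R) :
    (V × (Fin d → V)) →+ V where
  toFun ω := ∑ j, g j • ω.2 j
  map_zero' := by simp
  map_add' ω ω' := by
    simp only [Prod.snd_add, Pi.add_apply, smul_add, Finset.sum_add_distrib]

theorem affineEval_add_smul {R V : Type*} {d : ℕ} [CommRing R] [AddCommGroup V] [Module R V]
    (u g : Fin d → R) (c : R) (ω : V × (Fin d → V)) :
    affineEval (u + c • g) ω = affineEval u ω + c • linearEval g ω := by
  simp only [affineEval, linearEval, AddMonoidHom.coe_mk, ZeroHom.coe_mk, Pi.add_apply,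
    Pi.smul_apply, smul_eq_mul, add_smul, mul_smul, Finset.sum_add_distrib, Finset.smul_sum]
  abel

theorem affineEval_surjective {R V : Type*} {d : ℕ} [Ring R] [AddCommGroup V] [Module R V]
    (u : Fin d → R) : Function.Surjective (affineEval (V := V) u) := fun v =>
  ⟨(v, 0), by simp [affineEval]⟩

/-- A linear part supported at a coordinate where `g` is nonzero takes any prescribed value at `g`;
the translation then adjusts the value at `u`. -/
theorem affineEval_prod_linearEval_surjective {F V : Type*} {d : ℕ} [Field F] [AddCommGroup V]
    [Module F V] (u : Fin d → F) {g : Fin d → F} (hg : g ≠ 0) :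
    Function.Surjective ((affineEval (V := V) u).prod (linearEval g)) := by
  rintro ⟨v, e⟩
  obtain ⟨j, hj⟩ := Function.ne_iff.1 hg
  let m : Fin d → V := Pi.single j ((g j)⁻¹ • e)
  have hm : ∀ h : Fin d → F, ∑ i, h i • m i = h j • (g j)⁻¹ • e := by
    intro h
    rw [Finset.sum_eq_single j]
    · simp [m]
    · intro i _ hi
      simp [m, hi]
    · simp
  refine ⟨(v - ∑ i, u i • m i, m), ?_⟩
  simp only [affineEval, linearEval, AddMonoidHom.prod_apply, AddMonoidHom.coe_mk, ZeroHom.coe_mk,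
    sub_add_cancel, hm g, smul_inv_smul₀ hj]

/-- Counting triples in random affine images of a space of small dimension. -/
theorem density_sub_mul_sq_le_card_triplePairs {p : ℕ} [Fact p.Prime] {n : ℕ} {a₁ a₂ : ZMod p}
    (h₂ : a₂ ≠ 0) (A : Finset (Fin n → ZMod p)) (d : ℕ) {ρ : ℝ}
    (hρ : ((lowExponents p d).card : ℝ) ≤ (ρ * p) ^ d) :
    ((A.card : ℝ) / (p : ℝ) ^ n - 3 * ρ ^ d) * ((p : ℝ) ^ n) ^ 2 ≤
      ((p : ℝ) ^ d) ^ 2 * (triplePairs a₁ a₂ A).card := by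
  classical
  let V := Fin n → ZMod p
  let U := Fin d → ZMod p
  let Ω := V × (Fin d → V)
  have hp0 : (0 : ℝ) < p := by exact_mod_cast (Fact.out : p.Prime).pos
  have hV : Fintype.card V = p ^ n := by simp [V]
  have hU : Fintype.card U = p ^ d := by simp [U]
  set S := triplePairs a₁ a₂ A with hS
  let B : Ω → Finset U := fun ω => Finset.univ.filter fun u => affineEval u ω ∈ A
  let good : Finset Ω := Finset.univ.filter fun ω => 3 * (lowExponents p d).card < (B ω).card
  have hsum : (∑ ω : Ω, (B ω).card) * p ^ n = p ^ d * (A.card * Fintype.card Ω) := by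
    have h1 : ∑ ω : Ω, (B ω).card =
        ∑ u : U, (Finset.univ.filter fun ω : Ω => affineEval u ω ∈ A).card := by
      simp only [B, Finset.card_filter]
      exact Finset.sum_comm
    rw [h1, Finset.sum_mul, ← hV, Finset.sum_congr rfl fun u _ =>
      card_filter_mem_mul_card (affineEval (V := V) u) (affineEval_surjective u) A]
    rw [Finset.sum_const, Finset.card_univ, hU, smul_eq_mul]
  have hle : ∑ ω : Ω, (B ω).card ≤
      good.card * p ^ d + Fintype.card Ω * (3 * (lowExponents p d).card) := by
    rw [← Finset.sum_filter_add_sum_filter_not Finset.univ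
      (fun ω => 3 * (lowExponents p d).card < (B ω).card)]
    refine add_le_add ?_ ?_
    · refine (Finset.sum_le_card_nsmul _ _ (p ^ d) fun ω _ => ?_)
      rw [← hU]
      exact Finset.card_le_univ _
    · refine (Finset.sum_le_card_nsmul _ _ (3 * (lowExponents p d).card) fun ω hω => ?_).trans ?_
      · exact not_lt.1 (Finset.mem_filter.1 hω).2
      · exact Nat.mul_le_mul_right _ (Finset.card_le_univ _)
  -- Each good map sends some pair with nonzero difference into `S`. For a fixed such pair the image
  -- is uniform in `V × V`, so a union bound over at most `p ^ (2 d)` pairs suffices.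
  have hgood : good.card * (p ^ n) ^ 2 ≤ (p ^ d) ^ 2 * (S.card * Fintype.card Ω) := by
    let P : Finset (U × U) := Finset.univ.filter fun w => w.2 ≠ 0
    have hsub : good ⊆ P.biUnion fun w => Finset.univ.filter fun ω : Ω =>
        ((affineEval (V := V) w.1).prod (linearEval w.2)) ω ∈ S := by
      intro ω hω
      obtain ⟨w, hw, hw0⟩ := exists_triplePairs_ne_zero (a₁ := a₁) h₂ (B ω)
        (Finset.mem_filter.1 hω).2
      refine Finset.mem_biUnion.2 ⟨w, by simp [P, hw0], ?_⟩
      simp only [triplePairs, B, Finset.mem_filter, Finset.mem_univ, true_and, hS,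
        AddMonoidHom.prod_apply] at hw ⊢
      rw [affineEval_add_smul, sub_eq_add_neg, ← neg_smul, affineEval_add_smul, neg_smul,
        ← sub_eq_add_neg] at hw
      exact hw
    have hcard : ∀ w ∈ P, (Finset.univ.filter fun ω : Ω =>
        ((affineEval (V := V) w.1).prod (linearEval w.2)) ω ∈ S).card * (p ^ n) ^ 2 =
        S.card * Fintype.card Ω := by
      intro w hw
      rw [← card_filter_mem_mul_card _
        (affineEval_prod_linearEval_surjective (V := V) w.1 (Finset.mem_filter.1 hw).2) S,
        Fintype.card_prod, hV, sq]
    calc good.card * (p ^ n) ^ 2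
        ≤ (∑ w ∈ P, (Finset.univ.filter fun ω : Ω =>
        ((affineEval (V := V) w.1).prod (linearEval w.2)) ω ∈ S).card) * (p ^ n) ^ 2 :=
          Nat.mul_le_mul_right _ ((Finset.card_le_card hsub).trans Finset.card_biUnion_le)
      _ = P.card * (S.card * Fintype.card Ω) := by
          rw [Finset.sum_mul, Finset.sum_congr rfl hcard, Finset.sum_const, smul_eq_mul]
      _ ≤ _ := by
          refine Nat.mul_le_mul_right _ ((Finset.card_le_univ _).trans ?_)
          rw [Fintype.card_prod, hU, sq]
  have hΩ : (0 : ℝ) < Fintype.card Ω := by exact_mod_cast Fintype.card_pos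
  have hq : (0 : ℝ) < (p : ℝ) ^ n := by positivity
  have hr : (0 : ℝ) < (p : ℝ) ^ d := by positivity
  have hsumR : (∑ ω : Ω, ((B ω).card : ℝ)) * (p : ℝ) ^ n =
      (p : ℝ) ^ d * (A.card * Fintype.card Ω) := by exact_mod_cast hsum
  have hleR : (∑ ω : Ω, ((B ω).card : ℝ)) ≤
      good.card * (p : ℝ) ^ d + Fintype.card Ω * (3 * (lowExponents p d).card) := by
    exact_mod_cast hle
  have hgoodR : (good.card : ℝ) * ((p : ℝ) ^ n) ^ 2 ≤
      ((p : ℝ) ^ d) ^ 2 * (S.card * Fintype.card Ω) := by exact_mod_cast hgood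
  have h3 : (A.card : ℝ) / (p : ℝ) ^ n * Fintype.card Ω ≤
      good.card + Fintype.card Ω * (3 * ρ ^ d) := by
    have : (∑ ω : Ω, ((B ω).card : ℝ)) =
        (p : ℝ) ^ d * ((A.card : ℝ) / (p : ℝ) ^ n * Fintype.card Ω) := by
      field_simp
      linarith
    rw [mul_pow] at hρ
    rw [this] at hleR
    refine le_of_mul_le_mul_left ?_ hr
    nlinarith [mul_le_mul_of_nonneg_left hρ hΩ.le]
  refine le_of_mul_le_mul_right ?_ hΩ
  nlinarith [mul_le_mul_of_nonneg_right h3 (sq_nonneg ((p : ℝ) ^ n))]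

/-- Supersaturation for three-term configurations, with a polynomial dependence on the density. -/
theorem exists_le_card_triplePairs (p : ℕ) [Fact p.Prime] :
    ∃ (κ : ℝ) (C : ℕ), 0 < κ ∧ 1 ≤ C ∧ ∀ (n : ℕ) (a₁ a₂ : ZMod p), a₂ ≠ 0 →
      ∀ A : Finset (Fin n → ZMod p), κ * ((A.card : ℝ) / (p : ℝ) ^ n) ^ C * ((p : ℝ) ^ n) ^ 2 ≤
        (triplePairs a₁ a₂ A).card := by
  obtain ⟨ρ, h0, h1, hρ⟩ := exists_card_lowExponents_le p (Fact.out : p.Prime).two_le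
  have hp0 : (0 : ℝ) < p := by exact_mod_cast (Fact.out : p.Prime).pos
  -- `E` makes `p ^ 2` at most `ρ ^ (-E)`. With `d` minimal such that `3 ρ ^ d ≤ δ / 2`, the loss `p
  -- ^ (2 d)` is then at most a fixed power of `1 / δ`.
  obtain ⟨E, hE⟩ := exists_pow_lt_of_lt_one (show (0 : ℝ) < 1 / (p : ℝ) ^ 2 by positivity) h1
  refine ⟨(ρ / 6) ^ E / 2, E + 1, by positivity, by omega, fun n a₁ a₂ h₂ A => ?_⟩
  set δ : ℝ := (A.card : ℝ) / (p : ℝ) ^ n with hδ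
  have hq : (0 : ℝ) < (p : ℝ) ^ n := by positivity
  rcases A.eq_empty_or_nonempty with rfl | hne
  · simp [hδ]
  have hδ0 : 0 < δ := by
    have : (0 : ℝ) < A.card := by exact_mod_cast hne.card_pos
    positivity
  have hδ1 : δ ≤ 1 := by
    rw [hδ, div_le_one hq]
    have := Finset.card_le_univ A
    simp only [Fintype.card_pi, ZMod.card, Finset.prod_const, Finset.card_univ,
      Fintype.card_fin] at this
    exact_mod_cast this
  have hex : ∃ d, 3 * ρ ^ d ≤ δ / 2 := by
    obtain ⟨d, hd⟩ := exists_pow_lt_of_lt_one (show (0 : ℝ) < δ / 6 by positivity) h1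
    exact ⟨d, by linarith⟩
  classical
  let d := Nat.find hex
  have hd : 3 * ρ ^ d ≤ δ / 2 := Nat.find_spec hex
  have hd0 : d ≠ 0 := by
    intro h
    rw [h, pow_zero] at hd
    linarith
  obtain ⟨m, hm⟩ := Nat.exists_eq_succ_of_ne_zero hd0
  have hmin : ¬ 3 * ρ ^ m ≤ δ / 2 := Nat.find_min hex (by omega)
  have hρd : ρ / 6 * δ ≤ ρ ^ d := by
    rw [hm, pow_succ]
    nlinarith
  have hpd : (ρ / 6 * δ) ^ E * ((p : ℝ) ^ d) ^ 2 ≤ 1 := by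
    calc (ρ / 6 * δ) ^ E * ((p : ℝ) ^ d) ^ 2 ≤ (ρ ^ d) ^ E * ((p : ℝ) ^ d) ^ 2 := by gcongr
      _ = (ρ ^ E * (p : ℝ) ^ 2) ^ d := by
        rw [mul_pow, ← pow_mul, ← pow_mul, ← pow_mul, ← pow_mul, mul_comm d E, mul_comm d 2]
      _ ≤ 1 := by
        refine pow_le_one₀ (by positivity) ?_
        rw [lt_div_iff₀ (by positivity)] at hE
        exact hE.le
  have hmain := density_sub_mul_sq_le_card_triplePairs (a₁ := a₁) h₂ A d (hρ d)
  have h3 : δ / 2 * ((p : ℝ) ^ n) ^ 2 ≤ ((p : ℝ) ^ d) ^ 2 * (triplePairs a₁ a₂ A).card := by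
    refine le_trans ?_ hmain
    gcongr
    linarith
  calc (ρ / 6) ^ E / 2 * δ ^ (E + 1) * ((p : ℝ) ^ n) ^ 2
      = (ρ / 6 * δ) ^ E * (δ / 2 * ((p : ℝ) ^ n) ^ 2) := by rw [mul_pow, pow_succ]; ring
    _ ≤ (ρ / 6 * δ) ^ E * (((p : ℝ) ^ d) ^ 2 * (triplePairs a₁ a₂ A).card) := by gcongr
    _ = ((ρ / 6 * δ) ^ E * ((p : ℝ) ^ d) ^ 2) * (triplePairs a₁ a₂ A).card := by ring
    _ ≤ 1 * (triplePairs a₁ a₂ A).card := by gcongr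
    _ = _ := one_mul _

/-! ### Popular differences and merging of coefficients -/

/-- The equation `∑ i ∈ s, a i • x i = 0` has a solution in `A` with pairwise distinct entries. -/
def HasDistinctSolution {R V ι : Type*} [Ring R] [AddCommGroup V] [Module R V]
    (s : Finset ι) (a : ι → R) (A : Finset V) : Prop :=
  ∃ x : ι → V, Set.InjOn x s ∧ (∀ i ∈ s, x i ∈ A) ∧ ∑ i ∈ s, a i • x i = 0

theorem card_div_pow_le_one {p : ℕ} [NeZero p] {n : ℕ} (A : Finset (Fin n → ZMod p)) :
    (A.card : ℝ) / (p : ℝ) ^ n ≤ 1 := by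
  have hp0 : (0 : ℝ) < p := by exact_mod_cast Nat.pos_of_ne_zero (NeZero.ne p)
  rw [div_le_one (by positivity)]
  have := Finset.card_le_univ A
  simp only [Fintype.card_pi, ZMod.card, Finset.prod_const, Finset.card_univ,
    Fintype.card_fin] at this
  exact_mod_cast this

/-- A dense set contains many points starting a three-term configuration with a common
nonzero difference. -/
theorem exists_popular_triple (p : ℕ) [Fact p.Prime] :
    ∃ (κ : ℝ) (C : ℕ), 0 < κ ∧ 1 ≤ C ∧ ∀ (n : ℕ) (a₁ a₂ : ZMod p), a₂ ≠ 0 →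
      ∀ A : Finset (Fin n → ZMod p), ∃ (e : Fin n → ZMod p) (B : Finset (Fin n → ZMod p)),
        κ * ((A.card : ℝ) / (p : ℝ) ^ n) ^ C * (p : ℝ) ^ n - 1 ≤ B.card ∧
        (B.Nonempty → e ≠ 0) ∧ ∀ w ∈ B, w ∈ A ∧ w + a₂ • e ∈ A ∧ w - a₁ • e ∈ A := by
  classical
  obtain ⟨κ, C, hκ, hC, h⟩ := exists_le_card_triplePairs p
  refine ⟨κ, C, hκ, hC, fun n a₁ a₂ h₂ A => ?_⟩
  have hp0 : (0 : ℝ) < p := by exact_mod_cast (Fact.out : p.Prime).pos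
  have hq : (0 : ℝ) < (p : ℝ) ^ n := by positivity
  set δ : ℝ := (A.card : ℝ) / (p : ℝ) ^ n with hδ
  set q : ℝ := (p : ℝ) ^ n with hqdef
  let F : (Fin n → ZMod p) → Finset (Fin n → ZMod p) := fun e =>
    Finset.univ.filter fun w => w ∈ A ∧ w + a₂ • e ∈ A ∧ w - a₁ • e ∈ A
  have hS : (triplePairs a₁ a₂ A).card = ∑ e, (F e).card := by
    simp only [triplePairs, F, Finset.card_filter, Fintype.sum_prod_type]
    exact Finset.sum_comm
  have hF0 : ((F 0).card : ℝ) ≤ q := by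
    have := card_div_pow_le_one (F 0)
    rwa [div_le_one hq] at this
  by_cases hpos : κ * δ ^ C * q - 1 ≤ 0
  · exact ⟨0, ∅, by simpa using hpos, by simp, by simp⟩
  -- The difference `0` accounts for at most `q` pairs, so averaging over the other `q - 1`
  -- differences loses only the `- 1`.
  have hex : ∃ e ≠ 0, κ * δ ^ C * q - 1 ≤ (F e).card := by
    by_contra! hlt
    have h1 : ((triplePairs a₁ a₂ A).card : ℝ) ≤ (F 0).card +
        ∑ e ∈ Finset.univ.erase 0, ((F e).card : ℝ) := by
      rw [hS, Nat.cast_sum]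
      exact (Finset.add_sum_erase _ (fun e => ((F e).card : ℝ)) (Finset.mem_univ 0)).ge
    have h2 : ∑ e ∈ Finset.univ.erase 0, ((F e).card : ℝ) ≤
        (Finset.univ.erase (0 : Fin n → ZMod p)).card * (κ * δ ^ C * q - 1) := by
      rw [← nsmul_eq_mul]
      exact Finset.sum_le_card_nsmul _ _ _ fun e he => (hlt e (Finset.ne_of_mem_erase he)).le
    have h3 : ((Finset.univ.erase (0 : Fin n → ZMod p)).card : ℝ) = q - 1 := by
      rw [Finset.cast_card_erase_of_mem (Finset.mem_univ _)]
      simp [hqdef]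
    have h4 := h n a₁ a₂ h₂ A
    rw [h3] at h2
    have : κ * δ ^ C * q ^ 2 ≤ q + (q - 1) * (κ * δ ^ C * q - 1) := by
      linarith
    nlinarith
  obtain ⟨e, he, hle⟩ := hex
  exact ⟨e, F e, hle, fun _ => he, fun w hw => (Finset.mem_filter.1 hw).2⟩

/-- Two coefficients with nonzero sum can be merged into one at a polynomial cost in density. -/
theorem HasDistinctSolution.of_merge {F V ι : Type*} [Field F] [AddCommGroup V] [Module F V]
    [DecidableEq ι] {s : Finset ι} {a : ι → F} {i j : ι} (hi : i ∈ s) (hj : j ∈ s) (hij : i ≠ j)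
    (hai : a i ≠ 0) (haj : a j ≠ 0) (hsum : a i + a j ≠ 0) {A B : Finset V} {e : V}
    (f : V →ₗ[F] F) (c : F) (hf : f e ≠ 0)
    (hB : ∀ w ∈ B, (w ∈ A ∧ w + a j • e ∈ A ∧ w - a i • e ∈ A) ∧ f w = c)
    (h : HasDistinctSolution (s.erase j) (Function.update a i (a i + a j)) B) :
    HasDistinctSolution s a A := by
  obtain ⟨x, hinj, hmem, hx⟩ := h
  have hie : i ∈ s.erase j := Finset.mem_erase.2 ⟨hij, hi⟩
  let y : ι → V := Function.update (Function.update x i (x i + a j • e)) j (x i - a i • e)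
  have hyj : y j = x i - a i • e := by simp [y]
  have hyi : y i = x i + a j • e := by simp [y, hij]
  have hy : ∀ l, l ≠ i → l ≠ j → y l = x l := fun l h1 h2 => by simp [y, h1, h2]
  have hfx : ∀ l ∈ s, l ≠ j → f (x l) = c := fun l hl hlj =>
    (hB _ (hmem l (Finset.mem_erase.2 ⟨hlj, hl⟩))).2
  -- The functional `f` is constant on `B` but not along `e`, so the two new points differ from all
  -- the retained ones.
  have hfj : f (y j) ≠ c := by
    rw [hyj, map_sub, hfx i hi hij, map_smul, smul_eq_mul]
    simp [hai, hf]
  have hfi : f (y i) ≠ c := by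
    rw [hyi, map_add, hfx i hi hij, map_smul, smul_eq_mul]
    simp [haj, hf]
  have hyij : y i ≠ y j := by
    intro h
    have h' := congrArg f h
    rw [hyi, hyj, map_sub, map_add, map_smul, map_smul, smul_eq_mul, smul_eq_mul,
      ← sub_eq_zero] at h'
    have : (a i + a j) * f e = 0 := by linear_combination h'
    rcases mul_eq_zero.1 this with h0 | h0
    · exact hsum h0
    · exact hf h0
  have hfy : ∀ l ∈ s, l ≠ i → l ≠ j → f (y l) = c := fun l hl h1 h2 => by
    rw [hy l h1 h2, hfx l hl h2]
  refine ⟨y, ?_, ?_, ?_⟩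
  · intro k hk l hl hkl
    by_contra hne
    rcases eq_or_ne k j with rfl | hkj
    · rcases eq_or_ne l i with rfl | hli
      · exact hyij hkl.symm
      · exact hfj (hkl ▸ hfy l hl hli (Ne.symm hne))
    rcases eq_or_ne l j with rfl | hlj
    · rcases eq_or_ne k i with rfl | hki
      · exact hyij hkl
      · exact hfj (hkl ▸ hfy k hk hki hkj)
    rcases eq_or_ne k i with rfl | hki
    · exact hfi (hkl ▸ hfy l hl (Ne.symm hne) hlj)
    rcases eq_or_ne l i with rfl | hli
    · exact hfi (hkl ▸ hfy k hk hki hkj)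
    rw [hy k hki hkj, hy l hli hlj] at hkl
    exact hne (hinj (Finset.mem_erase.2 ⟨hkj, hk⟩) (Finset.mem_erase.2 ⟨hlj, hl⟩) hkl)
  · intro l hl
    rcases eq_or_ne l j with rfl | hlj
    · rw [hyj]
      exact (hB _ (hmem i hie)).1.2.2
    rcases eq_or_ne l i with rfl | hli
    · rw [hyi]
      exact (hB _ (hmem l hie)).1.2.1
    rw [hy l hli hlj]
    exact (hB _ (hmem l (Finset.mem_erase.2 ⟨hlj, hl⟩))).1.1
  · rw [← Finset.add_sum_erase _ _ hie, Function.update_self] at hx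
    rw [← Finset.add_sum_erase _ _ hj, ← Finset.add_sum_erase _ _ hie, hyj, hyi, ← hx]
    have : ∑ l ∈ (s.erase j).erase i, a l • y l =
        ∑ l ∈ (s.erase j).erase i, Function.update a i (a i + a j) l • x l := by
      refine Finset.sum_congr rfl fun l hl => ?_
      have h1 := Finset.ne_of_mem_erase hl
      have h2 := Finset.ne_of_mem_erase (Finset.mem_of_mem_erase hl)
      rw [hy l h1 h2, Function.update_of_ne h1]
    rw [this]
    module

theorem HasDistinctSolution.of_triple {F V ι : Type*} [Field F] [AddCommGroup V] [Module F V]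
    [DecidableEq ι] {a : ι → F} {i j l : ι} (hij : i ≠ j) (hil : i ≠ l) (hjl : j ≠ l)
    (hai : a i ≠ 0) (haj : a j ≠ 0) (hal : a l ≠ 0) (hsum : a i + a j + a l = 0)
    {A : Finset V} {w e : V} (he : e ≠ 0) (hw : w ∈ A) (hwi : w + a j • e ∈ A)
    (hwj : w - a i • e ∈ A) : HasDistinctSolution {i, j, l} a A := by
  have hneg : a i + a j ≠ 0 := by
    intro h
    rw [h, zero_add] at hsum
    exact hal hsum
  have h1 : w + a j • e ≠ w - a i • e := by
    intro h
    have : (a i + a j) • e = 0 := by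
      rw [add_smul]
      have := sub_eq_zero.2 h
      rw [← this]
      abel
    rcases smul_eq_zero.1 this with h0 | h0
    · exact hneg h0
    · exact he h0
  have h2 : w + a j • e ≠ w := by simp [haj, he]
  have h3 : w - a i • e ≠ w := by simp [hai, he]
  let y : ι → V := Function.update (Function.update (fun _ => w) i (w + a j • e)) j (w - a i • e)
  have hyj : y j = w - a i • e := by simp [y]
  have hyi : y i = w + a j • e := by simp [y, hij]
  have hyl : y l = w := by simp [y, hil.symm, hjl.symm]
  refine ⟨y, ?_, ?_, ?_⟩
  · intro u hu v hv huv
    simp only [Finset.coe_insert, Finset.coe_singleton, Set.mem_insert_iff,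
      Set.mem_singleton_iff] at hu hv
    rcases hu with rfl | rfl | rfl <;> rcases hv with rfl | rfl | rfl <;>
      simp only [hyi, hyj, hyl] at huv <;> first | rfl | exact absurd huv ‹_› |
        exact absurd huv.symm ‹_›
  · intro u hu
    simp only [Finset.mem_insert, Finset.mem_singleton] at hu
    rcases hu with rfl | rfl | rfl
    · rwa [hyi]
    · rwa [hyj]
    · rwa [hyl]
  · rw [Finset.sum_insert (by simp [hij, hil]), Finset.sum_pair hjl, hyi, hyj, hyl]
    have : a i • (w + a j • e) + (a j • (w - a i • e) + a l • w) = (a i + a j + a l) • w := by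
      module
    rw [this, hsum, zero_smul]

/-- If all pairs among three coefficients cancelled, then twice one of them would vanish. -/
theorem exists_pair_add_ne_zero {F ι : Type*} [Field F] (h2 : (2 : F) ≠ 0)
    {s : Finset ι} (hs : 3 ≤ s.card) {a : ι → F} (ha : ∀ i ∈ s, a i ≠ 0) :
    ∃ i ∈ s, ∃ j ∈ s, i ≠ j ∧ a i + a j ≠ 0 := by
  obtain ⟨i, j, l, hi, hj, hl, hij, hil, hjl⟩ := Finset.two_lt_card_iff.1 hs
  by_contra! h
  have e1 := h i hi j hj hij
  have e2 := h i hi l hl hil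
  have e3 := h j hj l hl hjl
  have : 2 * a i = 0 := by linear_combination e1 + e2 - e3
  rcases mul_eq_zero.1 this with h0 | h0
  · exact h2 h0
  · exact ha i hi h0

theorem exists_fiber_card_le {p : ℕ} [Fact p.Prime] {V : Type*} [DecidableEq V]
    (B : Finset V) (f : V → ZMod p) :
    ∃ c, (B.card : ℝ) / p ≤ (B.filter fun w => f w = c).card := by
  by_contra! h
  have hp0 : (0 : ℝ) < p := by exact_mod_cast (Fact.out : p.Prime).pos
  have h1 : (B.card : ℝ) = ∑ c, ((B.filter fun w => f w = c).card : ℝ) := by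
    rw [Finset.card_eq_sum_card_fiberwise (f := f) (t := Finset.univ) (fun _ _ => by simp)]
    push_cast
    rfl
  have h2 : ∑ c : ZMod p, ((B.filter fun w => f w = c).card : ℝ) <
      ∑ _c : ZMod p, (B.card : ℝ) / p :=
    Finset.sum_lt_sum_of_nonempty Finset.univ_nonempty fun c _ => h c
  rw [← h1, Finset.sum_const, Finset.card_univ, ZMod.card, nsmul_eq_mul,
    mul_div_cancel₀ _ hp0.ne'] at h2
  exact lt_irrefl _ h2

/-- For odd `p`, equations with a bounded number of variables have distinct solutions in every set
of density at least a small negative power of the size of the space. -/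
theorem exists_density_hasDistinctSolution_of_card_le {p : ℕ} [Fact p.Prime] (hp2 : p ≠ 2)
    (m : ℕ) :
    ∃ (D : ℕ) (K : ℝ), 1 ≤ D ∧ 0 < K ∧ ∀ {ι : Type} [DecidableEq ι] (n : ℕ) (s : Finset ι)
      (a : ι → ZMod p), 3 ≤ s.card → s.card ≤ m + 2 → (∀ i ∈ s, a i ≠ 0) → ∑ i ∈ s, a i = 0 →
      ∀ A : Finset (Fin n → ZMod p),
        K ≤ ((A.card : ℝ) / (p : ℝ) ^ n) ^ D * (p : ℝ) ^ n → HasDistinctSolution s a A := by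
  classical
  have hp : p.Prime := Fact.out
  have hp0 : (0 : ℝ) < p := by exact_mod_cast hp.pos
  have h2 : (2 : ZMod p) ≠ 0 := by
    intro h
    have : ((2 : ℕ) : ZMod p) = 0 := by exact_mod_cast h
    rw [ZMod.natCast_eq_zero_iff] at this
    exact hp2 ((Nat.prime_dvd_prime_iff_eq hp Nat.prime_two).1 this)
  induction m with
  | zero => exact ⟨1, 1, le_rfl, one_pos, fun n s a h3 h => absurd h3 (by omega)⟩
  | succ m ih =>
    obtain ⟨D, K, hD, hK, ih⟩ := ih
    obtain ⟨κ, C, hκ, hC, hpop⟩ := exists_popular_triple p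
    -- The first threshold absorbs the `- 1` in the size of `B` at the cost of a factor `2`; the
    -- second meets the induction hypothesis on a fibre of `B`, which costs a further factor `p`.
    refine ⟨C * D, max (2 / κ) (K / (κ / (2 * p)) ^ D), Nat.mul_pos hC hD,
      lt_max_of_lt_left (by positivity), ?_⟩
    intro ι _ n s a hs3 hsm ha hsum A hA
    have hq : (0 : ℝ) < (p : ℝ) ^ n := by positivity
    set q : ℝ := (p : ℝ) ^ n with hqdef
    set δ : ℝ := (A.card : ℝ) / q with hδ
    have hδ0 : 0 ≤ δ := by positivity
    have hδ1 : δ ≤ 1 := card_div_pow_le_one A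
    obtain ⟨i, hi, j, hj, hij, hne⟩ := exists_pair_add_ne_zero h2 hs3 ha
    obtain ⟨e, B, hBcard, hBe, hB⟩ := hpop n (a i) (a j) (ha j hj) A
    rw [← hqdef, ← hδ] at hBcard
    have hlarge : 2 ≤ κ * δ ^ C * q := by
      have h1 : 2 / κ ≤ δ ^ (C * D) * q := (le_max_left _ _).trans hA
      have h3 : δ ^ (C * D) ≤ δ ^ C :=
        pow_le_pow_of_le_one hδ0 hδ1 (Nat.le_mul_of_pos_right C hD)
      rw [div_le_iff₀ hκ] at h1
      nlinarith [mul_le_mul_of_nonneg_right h3 (mul_pos hq hκ).le]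
    have hBne : B.Nonempty := by
      rw [← Finset.card_pos]
      have : (0 : ℝ) < B.card := by linarith
      exact_mod_cast this
    have he := hBe hBne
    rcases Nat.lt_or_ge 3 s.card with hs4 | hs3'
    -- A coordinate in which `e` is nonzero serves as the separating functional.
    · obtain ⟨t, ht⟩ := Function.ne_iff.1 he
      obtain ⟨c, hc⟩ := exists_fiber_card_le B fun w => w t
      refine HasDistinctSolution.of_merge hi hj hij (ha i hi) (ha j hj) hne
        (LinearMap.proj t : (Fin n → ZMod p) →ₗ[ZMod p] ZMod p) c ht
        (B := B.filter fun w => w t = c) (fun w hw => ?_) (ih n _ _ ?_ ?_ ?_ ?_ _ ?_)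
      · have := Finset.mem_filter.1 hw
        exact ⟨hB w this.1, this.2⟩
      · rw [Finset.card_erase_of_mem hj]
        omega
      · rw [Finset.card_erase_of_mem hj]
        omega
      · intro l hl
        rcases eq_or_ne l i with rfl | hli
        · rwa [Function.update_self]
        · rw [Function.update_of_ne hli]
          exact ha l (Finset.mem_of_mem_erase hl)
      · have hie : i ∈ s.erase j := Finset.mem_erase.2 ⟨hij, hi⟩
        rw [Finset.sum_update_of_mem hie, ← hsum, ← Finset.add_sum_erase _ _ hj,
          ← Finset.add_sum_erase _ _ hie, Finset.sdiff_singleton_eq_erase]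
        ring
      · have h1 : κ / (2 * p) * δ ^ C ≤
            ((B.filter fun w => w t = c).card : ℝ) / q := by
          rw [le_div_iff₀ hq]
          refine le_trans ?_ hc
          rw [le_div_iff₀ hp0]
          have : κ / (2 * p) * δ ^ C * q * p = κ * δ ^ C * q / 2 := by field_simp
          rw [this]
          linarith
        have h3 : K / (κ / (2 * p)) ^ D ≤ δ ^ (C * D) * q := (le_max_right _ _).trans hA
        rw [div_le_iff₀ (by positivity)] at h3
        calc K ≤ δ ^ (C * D) * q * (κ / (2 * p)) ^ D := h3
          _ = (κ / (2 * p) * δ ^ C) ^ D * q := by rw [mul_pow, ← pow_mul]; ring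
          _ ≤ _ := by gcongr
    · obtain ⟨l, hl⟩ : ∃ l, (s.erase j).erase i = {l} := by
        rw [← Finset.card_eq_one, Finset.card_erase_of_mem (Finset.mem_erase.2 ⟨hij, hi⟩),
          Finset.card_erase_of_mem hj]
        omega
      have hl' : l ∈ (s.erase j).erase i := by simp [hl]
      have hs : s = {i, j, l} := by
        rw [← Finset.insert_erase hj, ← Finset.insert_erase (Finset.mem_erase.2 ⟨hij, hi⟩), hl]
        exact Finset.insert_comm _ _ _
      have hli := Finset.ne_of_mem_erase hl'
      have hlj := Finset.ne_of_mem_erase (Finset.mem_of_mem_erase hl')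
      have hls := Finset.mem_of_mem_erase (Finset.mem_of_mem_erase hl')
      obtain ⟨w, hw⟩ := hBne
      obtain ⟨hw1, hw2, hw3⟩ := hB w hw
      rw [hs] at hsum ⊢
      rw [Finset.sum_insert (by simp [hij, hli.symm]), Finset.sum_pair hlj.symm,
        ← add_assoc] at hsum
      exact HasDistinctSolution.of_triple hij hli.symm hlj.symm (ha i hi) (ha j hj) (ha l hls)
        hsum he hw1 hw2 hw3

/-! ### Splitting long equations -/

theorem HasDistinctSolution.of_sdiff {R V ι : Type*} [Ring R] [AddCommGroup V] [Module R V]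
    [DecidableEq ι] [DecidableEq V] {s t : Finset ι} {a : ι → R} {A : Finset V} (hts : t ⊆ s)
    (ht : HasDistinctSolution t a A)
    (h : ∀ X : Finset V, X.card = t.card → X ⊆ A → HasDistinctSolution (s \ t) a (A \ X)) :
    HasDistinctSolution s a A := by
  obtain ⟨x, hxinj, hxA, hx⟩ := ht
  obtain ⟨y, hyinj, hyA, hy⟩ := h (t.image x) (Finset.card_image_of_injOn hxinj) (by
    intro v hv
    obtain ⟨i, hi, rfl⟩ := Finset.mem_image.1 hv
    exact hxA i hi)
  have hcross : ∀ i ∈ t, ∀ j ∈ s, j ∉ t → x i ≠ y j := by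
    intro i hi j hj hjt hxy
    refine (Finset.mem_sdiff.1 (hyA j (Finset.mem_sdiff.2 ⟨hj, hjt⟩))).2 ?_
    rw [← hxy]
    exact Finset.mem_image_of_mem x hi
  refine ⟨fun i => if i ∈ t then x i else y i, ?_, ?_, ?_⟩
  · intro i hi j hj hij
    by_cases hit : i ∈ t <;> by_cases hjt : j ∈ t <;> simp only [hit, hjt, if_true, if_false] at hij
    · exact hxinj hit hjt hij
    · exact absurd hij (hcross i hit j hj hjt)
    · exact absurd hij.symm (hcross j hjt i hi hit)
    · exact hyinj (by simpa [hit] using hi) (by simpa [hjt] using hj) hij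
  · intro i hi
    by_cases hit : i ∈ t
    · simpa only [hit, if_true] using hxA i hit
    · simpa only [hit, if_false] using
        (Finset.mem_sdiff.1 (hyA i (Finset.mem_sdiff.2 ⟨hi, hit⟩))).1
  · rw [← Finset.sum_sdiff hts]
    have h1 : ∑ i ∈ s \ t, a i • (if i ∈ t then x i else y i) = ∑ i ∈ s \ t, a i • y i :=
      Finset.sum_congr rfl fun i hi => by rw [if_neg (Finset.mem_sdiff.1 hi).2]
    have h2 : ∑ i ∈ t, a i • (if i ∈ t then x i else y i) = ∑ i ∈ t, a i • x i :=
      Finset.sum_congr rfl fun i hi => by rw [if_pos hi]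
    rw [h1, h2, hx, hy, add_zero]

/-- If long equations split into shorter ones of the same kind, then solutions can be found
greedily, at the cost of removing at most as many points as there are variables. -/
theorem hasDistinctSolution_of_split {R V ι : Type*} [Ring R] [AddCommGroup V] [Module R V]
    [DecidableEq ι] [DecidableEq V] {a : ι → R} {m₀ B D : ℕ} {K q : ℝ} (hq : 0 < q)
    (hbase : ∀ s : Finset ι, m₀ ≤ s.card → s.card ≤ B → ∑ i ∈ s, a i = 0 → ∀ A : Finset V,
      K ≤ ((A.card : ℝ) / q) ^ D * q → HasDistinctSolution s a A)
    (hsplit : ∀ s : Finset ι, B < s.card →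
      ∃ t ⊂ s, m₀ ≤ t.card ∧ m₀ ≤ (s \ t).card ∧ ∑ i ∈ t, a i = 0 ∧ t.Nonempty)
    (s : Finset ι) (hs : m₀ ≤ s.card) (hsum : ∑ i ∈ s, a i = 0) (A : Finset V)
    (hsA : s.card ≤ A.card) (hK : K ≤ (((A.card : ℝ) - s.card) / q) ^ D * q) :
    HasDistinctSolution s a A := by
  induction hm : s.card using Nat.strong_induction_on generalizing s A with
  | _ m ih =>
    have hsA' : (s.card : ℝ) ≤ A.card := by exact_mod_cast hsA
    have h0 : 0 ≤ ((A.card : ℝ) - s.card) / q := div_nonneg (by linarith) hq.le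
    rcases Nat.lt_or_ge B s.card with hB | hB
    · obtain ⟨t, hts, ht, hst, htsum, htne⟩ := hsplit s hB
      have hlt := Finset.card_lt_card hts
      have hcard := Finset.card_sdiff_add_card_eq_card hts.subset
      have hcardR : (s.card : ℝ) = (s \ t).card + t.card := by exact_mod_cast hcard.symm
      have htpos := htne.card_pos
      refine HasDistinctSolution.of_sdiff hts.subset (ih _ (by omega) t ht htsum A (by omega) ?_ rfl)
        fun X hX hXA => ih _ (by omega) (s \ t) hst ?_ (A \ X) ?_ ?_ rfl
      · refine hK.trans ?_
        gcongr
      · rwa [← Finset.sum_sdiff hts.subset, htsum, add_zero] at hsum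
      · rw [Finset.card_sdiff_of_subset hXA]
        omega
      · rw [Finset.cast_card_sdiff hXA, hX]
        have : (A.card : ℝ) - t.card - (s \ t).card = A.card - s.card := by linarith
        rwa [this]
    · refine hbase s hs hB hsum A (hK.trans ?_)
      gcongr
      have : (0 : ℝ) ≤ s.card := Nat.cast_nonneg _
      linarith

/-! ### Parallelograms over the field with two elements -/

/-- There are `|A| ^ 2` pairs in `A`, and the differences in `X` account for at most `|X|` times the
size of `V`; the rest is averaged over the complement of `X`. -/
theorem exists_popular_difference {V : Type*} [AddCommGroup V] [Fintype V] [DecidableEq V]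
    (A X : Finset V) (hX : X.Nonempty) :
    ∃ (e : V) (B : Finset V), ((A.card : ℝ) / Fintype.card V) ^ 2 * Fintype.card V - X.card ≤ B.card ∧
      (B.Nonempty → e ∉ X) ∧ ∀ w ∈ B, w ∈ A ∧ w + e ∈ A := by
  set q : ℝ := (Fintype.card V : ℝ) with hqdef
  have hq : 0 < q := Nat.cast_pos.2 Fintype.card_pos
  set v : ℝ := ((A.card : ℝ) / q) ^ 2 * q - X.card with hv
  by_cases hpos : v ≤ 0
  · exact ⟨0, ∅, by simpa using hpos, by simp, by simp⟩
  let F : V → Finset V := fun e => A.filter fun w => w + e ∈ A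
  have hsum : ∑ e, (F e).card = A.card * A.card := by
    have h1 : ∀ w, (Finset.univ.filter fun e => w + e ∈ A).card = A.card := by
      intro w
      rw [← Finset.card_map (Equiv.addLeft w).toEmbedding]
      congr 1
      ext u
      simp only [Finset.mem_map, Finset.mem_filter, Finset.mem_univ, true_and,
        Equiv.coe_toEmbedding, Equiv.coe_addLeft]
      constructor
      · rintro ⟨e, he, rfl⟩
        exact he
      · exact fun hu => ⟨u - w, by simpa using hu, by abel⟩
    calc ∑ e, (F e).card = ∑ w ∈ A, (Finset.univ.filter fun e => w + e ∈ A).card := by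
          simp only [F, Finset.card_filter]
          exact Finset.sum_comm
      _ = A.card * A.card := by
          rw [Finset.sum_congr rfl fun w _ => h1 w, Finset.sum_const, smul_eq_mul]
  obtain ⟨e, heX, he⟩ : ∃ e, e ∉ X ∧ v ≤ (F e).card := by
    by_contra! hlt
    have hsumR : ∑ e ∈ X, ((F e).card : ℝ) + ∑ e ∈ Xᶜ, ((F e).card : ℝ) = A.card * A.card := by
      rw [Finset.sum_add_sum_compl]
      exact_mod_cast hsum
    have h1 : ∑ e ∈ X, ((F e).card : ℝ) ≤ X.card * q := by
      rw [← nsmul_eq_mul]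
      refine Finset.sum_le_card_nsmul _ _ _ fun e _ => ?_
      exact Nat.cast_le.2 (Finset.card_le_univ (F e))
    have h2 : ∑ e ∈ Xᶜ, ((F e).card : ℝ) ≤ Xᶜ.card * v := by
      rw [← nsmul_eq_mul]
      exact Finset.sum_le_card_nsmul _ _ _ fun e he => (hlt e (Finset.mem_compl.1 he)).le
    have h3 : (Xᶜ.card : ℝ) = q - X.card := by
      rw [Finset.card_compl, Nat.cast_sub (Finset.card_le_univ X)]
    have h4 : (v + X.card) * q = A.card * A.card := by
      rw [hv]
      field_simp
      ring
    have h5 : (0 : ℝ) < X.card := by exact_mod_cast hX.card_pos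
    rw [h3] at h2
    nlinarith [mul_pos h5 (not_le.1 hpos)]
  exact ⟨e, F e, he, fun _ => heX, fun w hw => Finset.mem_filter.1 hw⟩

theorem HasDistinctSolution.of_fin {R V ι : Type*} [Ring R] [AddCommGroup V] [Module R V]
    {s : Finset ι} {a : ι → R} {A : Finset V} {m : ℕ} (hs : s.card = m) (ha : ∀ i ∈ s, a i = 1)
    (v : Fin m → V) (hv : Function.Injective v) (hvA : ∀ j, v j ∈ A) (hsum : ∑ j, v j = 0) :
    HasDistinctSolution s a A := by
  classical
  let e : s ≃ Fin m := s.equivFinOfCardEq hs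
  have hx : ∀ (i : ι) (hi : i ∈ s), (if h : i ∈ s then v (e ⟨i, h⟩) else 0) = v (e ⟨i, hi⟩) :=
    fun i hi => dif_pos hi
  refine ⟨fun i => if h : i ∈ s then v (e ⟨i, h⟩) else 0, ?_, ?_, ?_⟩
  · intro i hi j hj hij
    beta_reduce at hij
    rw [hx i hi, hx j hj] at hij
    simpa using hv hij
  · intro i hi
    beta_reduce
    rw [hx i hi]
    exact hvA _
  · rw [← Finset.sum_coe_sort s]
    refine Eq.trans ?_ ((e.sum_comp v).trans hsum)
    refine Finset.sum_congr rfl fun i _ => ?_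
    beta_reduce
    rw [ha i i.2, one_smul, hx i i.2]

theorem eq_one_of_ne_zero_zmod_two {x : ZMod 2} (hx : x ≠ 0) : x = 1 := by
  revert hx x
  decide

theorem injective_translate_pairs {R : Type*} [CommRing R] (h2 : (2 : R) = 0) {x y z e f : R}
    (he : e ≠ 0) (hf : f ≠ 0) (hfe : f ≠ e)
    (hyx : y ≠ x ∧ y ≠ x + e ∧ y ≠ x + f ∧ y ≠ x + (e + f))
    (hzx : z ≠ x ∧ z ≠ x + e ∧ z ≠ x + f ∧ z ≠ x + (e + f))
    (hzy : z ≠ y ∧ z ≠ y + e ∧ z ≠ y + f ∧ z ≠ y + (e + f)) :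
    Function.Injective ![x, x + e, y, y + f, z, z + (e + f)] := by
  refine Function.Injective.of_lt_imp_ne fun i j hij => ?_
  fin_cases i <;> fin_cases j <;> first | exact absurd hij (by decide) | skip
  all_goals
    simp only [Fin.reduceFinMk, Fin.zero_eta, Fin.mk_one, Matrix.cons_val]
    grind only

/-- Equations in four or six variables over the field with two elements. -/
theorem hasDistinctSolution_two {ι : Type*} {n : ℕ} {s : Finset ι} {a : ι → ZMod 2}
    (hs : s.card = 4 ∨ s.card = 6) (ha : ∀ i ∈ s, a i = 1) (A : Finset (Fin n → ZMod 2))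
    (hA : 44 ≤ ((A.card : ℝ) / 2 ^ n) ^ 4 * 2 ^ n) : HasDistinctSolution s a A := by
  classical
  have hq : (0 : ℝ) < 2 ^ n := by positivity
  have hcard : (Fintype.card (Fin n → ZMod 2) : ℝ) = 2 ^ n := by simp
  obtain ⟨e, B, hBcard, hBe, hB⟩ := exists_popular_difference A {0} ⟨0, by simp⟩
  obtain ⟨f, C, hCcard, hCf, hC⟩ := exists_popular_difference B {0, e} ⟨0, by simp⟩
  rw [hcard] at hBcard hCcard
  set q : ℝ := 2 ^ n with hqdef
  set δ : ℝ := (A.card : ℝ) / q with hδ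
  have hδ0 : 0 ≤ δ := by positivity
  have hδ1 : δ ≤ 1 := by
    simpa [hδ, hqdef] using card_div_pow_le_one A
  have hδ2 : δ ^ 4 ≤ δ ^ 2 := pow_le_pow_of_le_one hδ0 hδ1 (by norm_num)
  have h1 : δ ^ 2 / 2 ≤ (B.card : ℝ) / q := by
    rw [le_div_iff₀ hq]
    have : δ ^ 4 * q ≤ δ ^ 2 * q := by gcongr
    simp only [Finset.card_singleton, Nat.cast_one] at hBcard
    linarith
  have h2 : (δ ^ 2 / 2) ^ 2 * q ≤ ((B.card : ℝ) / q) ^ 2 * q := by gcongr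
  have h3 : (({0, e} : Finset (Fin n → ZMod 2)).card : ℝ) ≤ 2 := by
    exact_mod_cast Finset.card_le_two
  -- The constant `44` gives `|C| ≥ 44 / 4 - 2 = 9`, enough to choose `z` off the eight translates
  -- of `x` and `y`.
  have h4 : (8 : ℝ) < C.card := by nlinarith
  have hC8 : 8 < C.card := by exact_mod_cast h4
  obtain ⟨x, hx⟩ : C.Nonempty := Finset.card_pos.1 (by omega)
  have hf := hCf ⟨x, hx⟩
  have he : e ≠ 0 := by simpa using hBe ⟨x, (hC x hx).1⟩
  simp only [Finset.mem_insert, Finset.mem_singleton, not_or] at hf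
  obtain ⟨hf0, hfe⟩ := hf
  have h2 : (2 : Fin n → ZMod 2) = 0 := by
    ext i
    exact (by decide : (2 : ZMod 2) = 0)
  have hA4 : ∀ w ∈ C, w ∈ A ∧ w + e ∈ A ∧ w + f ∈ A ∧ w + (e + f) ∈ A := by
    intro w hw
    obtain ⟨hw1, hw2⟩ := hC w hw
    refine ⟨(hB w hw1).1, (hB w hw1).2, (hB _ hw2).1, ?_⟩
    have := (hB _ hw2).2
    rwa [add_assoc, add_comm f e] at this
  obtain ⟨hx1, hx2, hx3, hx4⟩ := hA4 x hx
  rcases hs with hs | hs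
  · refine HasDistinctSolution.of_fin hs ha ![x, x + e, x + f, x + (e + f)] ?_ ?_ ?_
    · refine Function.Injective.of_lt_imp_ne fun i j hij => ?_
      fin_cases i <;> fin_cases j <;> first | exact absurd hij (by decide) | skip
      all_goals
        simp only [Fin.reduceFinMk, Fin.zero_eta, Fin.mk_one, Matrix.cons_val]
        grind only
    · simp only [Fin.forall_fin_succ, IsEmpty.forall_iff, and_true]
      exact ⟨hx1, hx2, hx3, hx4⟩
    · simp only [Fin.sum_univ_four, Matrix.cons_val]
      linear_combination (2 * x + e + f) * h2
  · obtain ⟨y, hy, hyx⟩ : ∃ y ∈ C, y ∉ ({x, x + e, x + f, x + (e + f)} : Finset _) := by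
      by_contra! h
      have := (Finset.card_le_card h).trans Finset.card_le_four
      omega
    obtain ⟨z, hz, hzxy⟩ : ∃ z ∈ C, z ∉ ({x, x + e, x + f, x + (e + f)} ∪
        {y, y + e, y + f, y + (e + f)} : Finset _) := by
      by_contra! h
      have := (Finset.card_le_card h).trans ((Finset.card_union_le _ _).trans
        (add_le_add Finset.card_le_four Finset.card_le_four))
      omega
    obtain ⟨hy1, hy2, hy3, hy4⟩ := hA4 y hy
    obtain ⟨hz1, hz2, hz3, hz4⟩ := hA4 z hz
    simp only [Finset.mem_union, Finset.mem_insert, Finset.mem_singleton, not_or] at hyx hzxy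
    -- Three pairs with differences `e`, `f`, `e + f` sum to zero in characteristic two.
    refine HasDistinctSolution.of_fin hs ha ![x, x + e, y, y + f, z, z + (e + f)] ?_ ?_ ?_
    · exact injective_translate_pairs h2 he hf0 hfe hyx hzxy.1 hzxy.2
    · simp only [Fin.forall_fin_succ, IsEmpty.forall_iff, and_true]
      exact ⟨hx1, hx2, hy1, hy3, hz1, hz4⟩
    · simp only [Fin.sum_univ_six, Matrix.cons_val]
      linear_combination (x + y + z + e + f) * h2

/-! ### Equations of arbitrary length and the final bound -/

theorem exists_density_hasDistinctSolution (p : ℕ) [Fact p.Prime] :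
    ∃ (D : ℕ) (K : ℝ), 1 ≤ D ∧ 0 < K ∧ ∀ k n : ℕ, 6 ≤ k → ∀ a : Fin k → ZMod p,
      (∀ i, a i ≠ 0) → ∑ i, a i = 0 → ∀ A : Finset (Fin n → ZMod p), k ≤ A.card →
        K ≤ (((A.card : ℝ) - k) / (p : ℝ) ^ n) ^ D * (p : ℝ) ^ n →
          HasDistinctSolution Finset.univ a A := by
  have hp : p.Prime := Fact.out
  have hp0 : (0 : ℝ) < p := by exact_mod_cast hp.pos
  by_cases hp2 : p = 2
  · subst hp2
    refine ⟨4, 44, by norm_num, by norm_num, fun k n hk a ha hsum A hkA hK => ?_⟩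
    have ha1 : ∀ i, a i = 1 := fun i => eq_one_of_ne_zero_zmod_two (ha i)
    -- Zero sum forces even length, so lengths from `4` to `7` mean `4` or `6`; from length `8` on,
    -- four variables can be split off leaving at least four.
    refine hasDistinctSolution_of_split (m₀ := 4) (B := 7) (q := (2 : ℕ) ^ n) (K := 44) (D := 4)
      (by positivity) ?_ ?_ Finset.univ (by simp; omega) hsum A (by simpa using hkA)
      (by simpa using hK)
    · intro s hs4 hs7 hs A hA
      refine hasDistinctSolution_two ?_ (fun i _ => ha1 i) A (by exact_mod_cast hA)
      simp only [ha1, Finset.sum_const, nsmul_eq_mul, mul_one, ZMod.natCast_eq_zero_iff] at hs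
      omega
    · intro s hs
      obtain ⟨t, hts, ht⟩ := Finset.exists_subset_card_eq (show 4 ≤ s.card by omega)
      have hcard := Finset.card_sdiff_add_card_eq_card hts
      refine ⟨t, hts.ssubset_of_ne ?_, ht.ge, by omega, ?_, Finset.card_pos.1 (by omega)⟩
      · rintro rfl
        omega
      · simp only [ha1, Finset.sum_const, ht]
        rfl
  · have hp3 : 3 ≤ p := by
      have := hp.two_le
      omega
    obtain ⟨D, K, hD, hK, h⟩ := exists_density_hasDistinctSolution_of_card_le hp2 (2 * p)
    refine ⟨D, K, hD, hK, fun k n hk a ha hsum A hkA hKA => ?_⟩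
    refine hasDistinctSolution_of_split (m₀ := 3) (B := 2 * p + 2) (q := (p : ℝ) ^ n) (K := K)
      (D := D) (by positivity) ?_ ?_ Finset.univ (by simp; omega) hsum A (by simpa using hkA)
      (by simpa using hKA)
    · exact fun s hs3 hs hs0 A hA => h n s a hs3 hs (fun i _ => ha i) hs0 A hA
    · intro s hs
      -- The zero-sum block has `p ≥ 3` variables and at least `p + 3` remain, so both parts are
      -- long enough.
      obtain ⟨t, hts, ht, ht0⟩ := ZMod.erdos_ginzburg_ziv (n := p) (s := s) a (by omega)
      have hcard := Finset.card_sdiff_add_card_eq_card hts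
      refine ⟨t, hts.ssubset_of_ne ?_, by omega, by omega, ht0, Finset.card_pos.1 (by omega)⟩
      rintro rfl
      omega

theorem mainTheorem4 (p : ℕ) [Fact p.Prime] :
    ∃ c : ℝ, 0 < c ∧
      ∀ (k n : ℕ), 6 ≤ k →
      ∀ a : Fin k → ZMod p, (∀ i, a i ≠ 0) → ∑ i, a i = 0 →
      ∀ A : Finset (Fin n → ZMod p),
        (¬ ∃ x : Fin k → (Fin n → ZMod p),
            Function.Injective x ∧ (∀ i, x i ∈ A) ∧ ∑ i, a i • x i = 0) →
        (A.card : ℝ) ≤ (k : ℝ) * (p : ℝ) ^ n *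
          Real.exp (-(c * min (((k : ℝ) ^ 3 * Real.logb 2 ((p : ℝ) ^ n)) ^ (1 / 5 : ℝ))
            (Real.logb 2 ((p : ℝ) ^ n)))) := by
  obtain ⟨D, K, hD, hK, hmain⟩ := exists_density_hasDistinctSolution p
  have hp1 : (1 : ℝ) ≤ p := by exact_mod_cast (Fact.out : p.Prime).one_le
  have hlog2 : 0 < Real.log 2 := Real.log_pos one_lt_two
  set K₁ : ℝ := max (K ^ 2) 4 with hK₁
  have hK₁4 : 4 ≤ K₁ := le_max_right _ _
  have hlogK : 0 < Real.logb 2 K₁ := Real.logb_pos one_lt_two (by linarith)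
  have hDpos : (0 : ℝ) < D := by exact_mod_cast hD
  -- The first term makes the bound trivial for `q ≤ K₁`, where `E ≥ 1 / 3` and `k ≥ 6`. The second
  -- gives `E ^ (2 D) ≥ 1 / q`, hence `E ^ D q ≥ √q ≥ K` for larger `q`.
  refine ⟨min (1 / Real.logb 2 K₁) (Real.log 2 / (2 * D)), by positivity, ?_⟩
  intro k n hk a ha hsum A hA
  set c : ℝ := min (1 / Real.logb 2 K₁) (Real.log 2 / (2 * D)) with hc
  have hc0 : 0 < c := by positivity
  have hc1 : c * Real.logb 2 K₁ ≤ 1 := by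
    rw [← le_div_iff₀ hlogK]
    exact min_le_left _ _
  have hc2 : c * (2 * D) ≤ Real.log 2 := by
    rw [← le_div_iff₀ (by positivity)]
    exact min_le_right _ _
  set q : ℝ := (p : ℝ) ^ n with hqdef
  have hq1 : 1 ≤ q := one_le_pow₀ hp1
  have hq : 0 < q := by linarith
  have hL0 : 0 ≤ Real.logb 2 q := Real.logb_nonneg one_lt_two hq1
  have hAq : (A.card : ℝ) ≤ q := by
    have := card_div_pow_le_one A
    rwa [div_le_one hq] at this
  have hk6 : (6 : ℝ) ≤ k := by exact_mod_cast hk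
  set E : ℝ := Real.exp (-(c * Real.logb 2 q)) with hE
  have hE0 : 0 < E := Real.exp_pos _
  suffices h : (A.card : ℝ) ≤ k * q * E by
    exact h.trans (mul_le_mul_of_nonneg_left (Real.exp_le_exp.2 (neg_le_neg
      (mul_le_mul_of_nonneg_left (min_le_right _ _) hc0.le))) (by positivity))
  rcases le_or_gt q K₁ with hqK | hqK
  · have h1 : c * Real.logb 2 q ≤ 1 :=
      (mul_le_mul_of_nonneg_left (Real.logb_le_logb_of_le one_lt_two hq hqK) hc0.le).trans hc1
    have h2 : 1 / 3 ≤ E := by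
      have h3 : Real.exp (-1) ≤ E := Real.exp_le_exp.2 (by linarith)
      have h4 : (1 : ℝ) / 3 ≤ Real.exp (-1) := by
        rw [Real.exp_neg, ← one_div]
        exact one_div_le_one_div_of_le (Real.exp_pos 1) (by linarith [Real.exp_one_lt_d9])
      linarith
    calc (A.card : ℝ) ≤ q := hAq
      _ ≤ 6 * q * (1 / 3) := by linarith
      _ ≤ k * q * E := by gcongr
  · by_contra! hlt
    have hE1 : E ≤ 1 := Real.exp_le_one_iff.2 (by
      have := mul_nonneg hc0.le hL0
      linarith)
    have hED : 1 ≤ E ^ (2 * D) * q := by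
      have hlogq : Real.logb 2 q * Real.log 2 = Real.log q := by
        rw [Real.logb]
        field_simp
      have hqexp : q = Real.exp (Real.logb 2 q * Real.log 2) := by
        rw [hlogq, Real.exp_log hq]
      have hEpow : E ^ (2 * D) = Real.exp (-(c * (2 * D) * Real.logb 2 q)) := by
        rw [hE, ← Real.exp_nat_mul]
        congr 1
        push_cast
        ring
      have : E ^ (2 * D) * q =
          Real.exp (-(c * (2 * D) * Real.logb 2 q) + Real.logb 2 q * Real.log 2) := by
        rw [Real.exp_add, ← hqexp, hEpow]
      rw [this, Real.one_le_exp_iff]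
      nlinarith
    have hEDK : K ≤ E ^ D * q := by
      refine (sq_le_sq₀ (by positivity) (by positivity)).1 ?_
      calc K ^ 2 ≤ q := (le_max_left _ _).trans hqK.le
        _ = 1 * q := (one_mul q).symm
        _ ≤ E ^ (2 * D) * q * q := by gcongr
        _ = (E ^ D * q) ^ 2 := by ring
    have hEq : 2 ≤ E * q := by
      refine (sq_le_sq₀ (by positivity) (by positivity)).1 ?_
      calc (2 : ℝ) ^ 2 ≤ q := by linarith
        _ = 1 * q := (one_mul q).symm
        _ ≤ E ^ (2 * D) * q * q := by gcongr
        _ ≤ E ^ 2 * q * q := by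
          have : E ^ (2 * D) ≤ E ^ 2 := pow_le_pow_of_le_one hE0.le hE1 (by omega)
          gcongr
        _ = (E * q) ^ 2 := by ring
    -- As `E q ≥ 2`, removing `k` points from more than `k E q` leaves at least `E q`.
    have hdens : E * q ≤ A.card - k := by nlinarith
    obtain ⟨x, hinj, hxA, hx⟩ := hmain k n hk a ha hsum A (by
      have : (k : ℝ) ≤ A.card := by linarith
      exact_mod_cast this) (by
      refine hEDK.trans ?_
      have : E ≤ (A.card - k) / q := by rwa [le_div_iff₀ hq]
      gcongr)
    refine hA ⟨x, fun i j hij => hinj (by simp) (by simp) hij, fun i => hxA i (by simp), hx⟩
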